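/- Let $\gamma_{\times 2,t}(G)$ denote the minimum size of a $2$-tuple total dominating set of a graph $G$, i.e. of a set $S\subseteq V(G)$ such that every vertex of $G$ has at least $2$ neighbours in $S$. For an $n\times m$ $(0,1)$-matrix $M=(m_{ij})$ put $\kappa(i,j)=\sum_{z} m_{iz}+\sum_{z} m_{zj}-2m_{ij}$. Call $M$ a $2$TDS matrix if $\kappa(i,j)\ge 2$ for all cells $(i,j)$, and a min-$2$TDS matrix if moreover it has exactly $\gamma_{\times 2,t}(K_n\Box K_m)$ ones, where $\Box$ is the Cartesian product of graphs. Let $\Gamma(M)$ be the graph whose vertices are the ones of $M$, two distinct ones being adjacent if they lie in the same row or in the same column with no ones between them. A component of $M$ is a connected component of $\Gamma(M)$, regarded as the submatrix of $M$ on the rows and columns that it meets. Let $J(x,y)$ be the $x\times y$ all-ones matrix. Let $n,m\ge 1$ with $(n,m)\notin\{(1,1),(1,2),(2,1),(2,2),(3,3),(3,4),(4,3)\}$. If there exists an $n\times m$ min-$2$TDS matrix with no all-$0$ rows and no all-$0$ columns, then there exists an $n\times m$ min-$2$TDS matrix $M$ whose components, up to permutations of the rows and columns, are all $J(1,3)$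 or $J(3,1)$, except possibly for one of the following: - exactly one $J(x,1)$ component with $4\le x\le 7$; - exactly one $J(1,y)$ component with $4\le y\le 7$; or - exactly one $J(x,1)$ component with $4\le x\le 5$ and exactly one $J(1,y)$ component with $4\le y\le 5$. Further, the number of ones in $M$ is $$\begin{cases}\lceil 3(n+m)/4\rceil+1 & \text{if } m\equiv 3n+4 \pmod 8,\\ \lceil 3(n+m)/4\rceil & \text{otherwise.}\end{cases}$$ -/

import Mathlib

namespace RookDom

/-- `S` is a `k`-tuple total dominating set of `G`: every vertex of `G` has at least `k`
neighbours in `S`. -/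
def IsKTDS {V : Type*} [Fintype V] (G : SimpleGraph V) (k : ℕ) (S : Finset V) : Prop :=
  ∀ v : V, k ≤ {w : V | w ∈ S ∧ G.Adj v w}.ncard

/-- The `k`-tuple total domination number: the minimum cardinality of a `k`-tuple total dominating
set (with value `0` when there is none; a min-`k`TDS matrix is also required to be a `k`TDS matrix,
so this convention is never used). -/
noncomputable def gammaT {V : Type*} [Fintype V] (G : SimpleGraph V) (k : ℕ) : ℕ :=
  sInf {s : ℕ | ∃ S : Finset V, IsKTDS G k S ∧ S.card = s}

/-- The `n × m` rook's graph `K_n □ K_m`. -/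
def rookGraph (n m : ℕ) : SimpleGraph (Fin n × Fin m) :=
  SimpleGraph.boxProd (⊤ : SimpleGraph (Fin n)) (⊤ : SimpleGraph (Fin m))

/-- `M` is a `(0,1)`-matrix. -/
def IsZeroOne {n m : ℕ} (M : Matrix (Fin n) (Fin m) ℕ) : Prop :=
  ∀ i j, M i j = 0 ∨ M i j = 1

/-- `κ(i,j)`: the `i`-th row sum plus the `j`-th column sum minus twice the entry `(i,j)`. -/
def kappa {n m : ℕ} (M : Matrix (Fin n) (Fin m) ℕ) (i : Fin n) (j : Fin m) : ℤ :=
  (∑ z : Fin m, (M i z : ℤ)) + (∑ z : Fin n, (M z j : ℤ)) - 2 * (M i j : ℤ)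

/-- A `k`TDS matrix: a `(0,1)`-matrix with `κ(i,j) ≥ k` for all cells `(i,j)`. -/
def IsKTDSMatrix {n m : ℕ} (k : ℕ) (M : Matrix (Fin n) (Fin m) ℕ) : Prop :=
  IsZeroOne M ∧ ∀ i j, (k : ℤ) ≤ kappa M i j

/-- The number of ones of a matrix. -/
def numOnes {n m : ℕ} (M : Matrix (Fin n) (Fin m) ℕ) : ℕ :=
  (Finset.univ.filter fun p : Fin n × Fin m => M p.1 p.2 = 1).card

/-- A min-`k`TDS matrix: a `k`TDS matrix whose number of ones is the `k`-tuple total domination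
number of the rook's graph. -/
def IsMinKTDSMatrix {n m : ℕ} (k : ℕ) (M : Matrix (Fin n) (Fin m) ℕ) : Prop :=
  IsKTDSMatrix k M ∧ numOnes M = gammaT (rookGraph n m) k

/-- No row and no column of `M` is identically zero. -/
def NoZeroLine {n m : ℕ} (M : Matrix (Fin n) (Fin m) ℕ) : Prop :=
  (∀ i, ∃ j, M i j ≠ 0) ∧ (∀ j, ∃ i, M i j ≠ 0)

/-- The positions of the ones of `M`. -/
abbrev OneCell {n m : ℕ} (M : Matrix (Fin n) (Fin m) ℕ) : Type :=
  {p : Fin n × Fin m // M p.1 p.2 = 1}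

/-- The graph `Γ(M)` on the ones of `M`: two different ones are adjacent if they lie in the same
row, or in the same column, and there are no ones between them. -/
def gammaGraph {n m : ℕ} (M : Matrix (Fin n) (Fin m) ℕ) : SimpleGraph (OneCell M) where
  Adj p q := p ≠ q ∧
    ((p.1.1 = q.1.1 ∧
        ∀ j : Fin m, min p.1.2 q.1.2 < j → j < max p.1.2 q.1.2 → M p.1.1 j ≠ 1) ∨
     (p.1.2 = q.1.2 ∧
        ∀ i : Fin n, min p.1.1 q.1.1 < i → i < max p.1.1 q.1.1 → M i p.1.2 ≠ 1))
  symm := ⟨by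
    rintro p q ⟨hne, h⟩
    refine ⟨hne.symm, ?_⟩
    rcases h with ⟨h, h'⟩ | ⟨h, h'⟩
    · left
      refine ⟨h.symm, fun j h1 h2 => ?_⟩
      rw [← h]
      exact h' j (by rwa [min_comm]) (by rwa [max_comm])
    · right
      refine ⟨h.symm, fun i h1 h2 => ?_⟩
      rw [← h]
      exact h' i (by rwa [min_comm]) (by rwa [max_comm])⟩
  loopless := ⟨fun _ h => h.1 rfl⟩

/-- A (connected) component of `M`: a connected component of `Γ(M)`. -/
abbrev Component {n m : ℕ} (M : Matrix (Fin n) (Fin m) ℕ) : Type :=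
  (gammaGraph M).ConnectedComponent

/-- The rows of `M` that the component `c` meets. -/
def Component.rows {n m : ℕ} {M : Matrix (Fin n) (Fin m) ℕ} (c : Component M) : Set (Fin n) :=
  {i | ∃ p : OneCell M, (gammaGraph M).connectedComponentMk p = c ∧ p.1.1 = i}

/-- The columns of `M` that the component `c` meets. -/
def Component.cols {n m : ℕ} {M : Matrix (Fin n) (Fin m) ℕ} (c : Component M) : Set (Fin m) :=
  {j | ∃ p : OneCell M, (gammaGraph M).connectedComponentMk p = c ∧ p.1.2 = j}

/-- The component `c` of `M`, i.e. the submatrix of `M` on the rows and columns that `c` meets, is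
the `x × y` matrix `A` up to permutations of the rows and columns. -/
def Component.IsEquivTo {n m x y : ℕ} {M : Matrix (Fin n) (Fin m) ℕ} (c : Component M)
    (A : Matrix (Fin x) (Fin y) ℕ) : Prop :=
  ∃ (e : Fin x ≃ Component.rows c) (f : Fin y ≃ Component.cols c),
    M.submatrix (fun i => (e i : Fin n)) (fun j => (f j : Fin m)) = A

/-- `J(x,y)`: the `x × y` all-ones matrix. -/
def J (x y : ℕ) : Matrix (Fin x) (Fin y) ℕ := Matrix.of fun _ _ => 1

/-- The component `c` is `J(1,3)` or `J(3,1)`. -/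
def Component.IsShort {n m : ℕ} {M : Matrix (Fin n) (Fin m) ℕ} (c : Component M) : Prop :=
  Component.IsEquivTo c (J 1 3) ∨ Component.IsEquivTo c (J 3 1)

end RookDom

/-! Lower bound: in a 2TDS matrix without zero lines, give each one the weight 1/r + 1/c, where r
and c are its row and column sums. The weights add up to n + m (`sum_weights`). Since r + c ≥ 4,
each weight is at most 4/3 (`inv_add_inv_le`), so 3(n + m) ≤ 4N for N ones (`three_mul_le`).
Equality forces odd row sums, hence N ≡ n mod 2, which fails when m ≡ 3n + 4 mod 8 (`three_mul_ne`);
this is the extra 1.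

Construction: `starMatrix` is a disjoint union of a row stars and b column stars with three leaves
each, where the last row star has t extra leaves and the last column star s. Then n = a + 3b + s, m
= b + 3a + t, and the number L of ones satisfies 4L = 3(n + m) + s + t. Solving for a, b, s, t
(`exists_star_parameters`) requires that neither side is too long. This follows from the hypothesis:
two full rows or columns bound γ by 2m or 2n, while a minimum matrix without zero lines has at least
3(n + m)/4 ones. -/

namespace RookDom

/-! ### Counting ones: the lower bound -/

section Counting

variable {n m : ℕ} {M : Matrix (Fin n) (Fin m) ℕ}

lemma numOnes_eq_sum (hM : IsZeroOne M) : numOnes M = ∑ i, ∑ j, M i j := by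
  rw [numOnes, Finset.card_filter, Fintype.sum_prod_type]
  refine Finset.sum_congr rfl fun i _ => Finset.sum_congr rfl fun j _ => ?_
  rcases hM i j with h | h <;> simp [h]

/-- A cell is not its own neighbour, but its entry occurs in both its row sum and its column sum,
hence the subtraction of twice the entry. -/
lemma kappa_eq_ncard (hM : IsZeroOne M) (i : Fin n) (j : Fin m) :
    kappa M i j = {w : Fin n × Fin m |
      w ∈ Finset.univ.filter (fun p : Fin n × Fin m => M p.1 p.2 = 1) ∧
        (rookGraph n m).Adj (i, j) w}.ncard := by
  classical
  have h1 : {w : Fin n × Fin m |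
      w ∈ Finset.univ.filter (fun p : Fin n × Fin m => M p.1 p.2 = 1) ∧
        (rookGraph n m).Adj (i, j) w} =
      ↑(Finset.univ.filter fun w : Fin n × Fin m =>
        M w.1 w.2 = 1 ∧ (rookGraph n m).Adj (i, j) w) := by
    ext w; simp
  rw [h1, Set.ncard_coe_finset, Finset.card_filter, Nat.cast_sum, Fintype.sum_prod_type]
  have h2 : ∀ x y, ((if M x y = 1 ∧ (rookGraph n m).Adj (i, j) (x, y) then 1 else 0 : ℕ) : ℤ) =
      (if x = i then (M x y : ℤ) else 0) + (if y = j then (M x y : ℤ) else 0)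
        - 2 * (if x = i then if y = j then (M x y : ℤ) else 0 else 0) := by
    intro x y
    simp only [rookGraph, SimpleGraph.boxProd_adj, SimpleGraph.top_adj]
    rcases eq_or_ne x i with rfl | hx <;> rcases eq_or_ne y j with rfl | hy
    · rcases hM x y with h | h <;> simp [h]
    · rcases hM x y with h | h <;> simp [h, hy, hy.symm]
    · rcases hM x y with h | h <;> simp [h, hx, hx.symm]
    · simp [hx, hy, hx.symm, hy.symm]
  simp only [h2, Finset.sum_add_distrib, Finset.sum_sub_distrib, ← Finset.mul_sum]
  have h3 : ∑ x, ∑ y, (if x = i then (M x y : ℤ) else 0) = ∑ y, (M i y : ℤ) := by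
    rw [Finset.sum_comm]; simp
  have h4 : ∑ x, ∑ y, (if x = i then if y = j then (M x y : ℤ) else 0 else 0) = M i j := by
    rw [Finset.sum_comm]; simp
  rw [h3, h4]
  simp [kappa]

/-- The only link needed between γ and matrices: attainment of the minimum is part of the hypothesis
of the theorem. -/
lemma gammaT_le_numOnes {k : ℕ} (hM : IsKTDSMatrix k M) :
    gammaT (rookGraph n m) k ≤ numOnes M := by
  refine Nat.sInf_le ⟨_, fun v => ?_, rfl⟩
  have h := hM.2 v.1 v.2
  rw [kappa_eq_ncard hM.1] at h
  exact_mod_cast h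

lemma row_sum_pos (hz : NoZeroLine M) (i : Fin n) : 1 ≤ ∑ z, M i z := by
  obtain ⟨j, hj⟩ := hz.1 i
  exact (Nat.one_le_iff_ne_zero.2 hj).trans
    (Finset.single_le_sum (f := fun z => M i z) (fun _ _ => Nat.zero_le _) (Finset.mem_univ j))

lemma col_sum_pos (hz : NoZeroLine M) (j : Fin m) : 1 ≤ ∑ z, M z j := by
  obtain ⟨i, hi⟩ := hz.2 j
  exact (Nat.one_le_iff_ne_zero.2 hi).trans
    (Finset.single_le_sum (f := fun z => M z j) (fun _ _ => Nat.zero_le _) (Finset.mem_univ i))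

lemma four_le_of_one (hM : IsKTDSMatrix 2 M) {i : Fin n} {j : Fin m} (h : M i j = 1) :
    4 ≤ ∑ z, M i z + ∑ z, M z j := by
  have := hM.2 i j
  simp only [kappa, h] at this
  zify
  push_cast at this
  linarith

/-- With r = 1 + r' and c = 1 + c' the inequality reads 2 ≤ r' + c' + 4r'c', so equality holds only
for {r, c} = {1, 3}. -/
lemma inv_add_inv_le {r c : ℕ} (hr : 1 ≤ r) (hc : 1 ≤ c) (h : 4 ≤ r + c) :
    (r : ℚ)⁻¹ + (c : ℚ)⁻¹ ≤ 4 / 3 ∧ ((r : ℚ)⁻¹ + (c : ℚ)⁻¹ = 4 / 3 → r = 1 ∨ r = 3) := by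
  have hr0 : (0 : ℚ) < r := by exact_mod_cast hr
  have hc0 : (0 : ℚ) < c := by exact_mod_cast hc
  have h0 : (r : ℚ)⁻¹ + (c : ℚ)⁻¹ = ((r + c : ℕ) : ℚ) / ((r * c : ℕ) : ℚ) := by
    push_cast; field_simp; ring
  have hpos : (0 : ℚ) < ((r * c : ℕ) : ℚ) := by push_cast; positivity
  obtain ⟨r, rfl⟩ := Nat.exists_eq_add_of_le hr
  obtain ⟨c, rfl⟩ := Nat.exists_eq_add_of_le hc
  rw [h0]
  constructor
  · rw [div_le_div_iff₀ hpos (by norm_num)]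
    have : (1 + r + (1 + c)) * 3 ≤ 4 * ((1 + r) * (1 + c)) := by nlinarith [Nat.zero_le (r * c)]
    exact_mod_cast this
  · intro he
    rw [div_eq_div_iff hpos.ne' (by norm_num)] at he
    have he' : (1 + r + (1 + c)) * 3 = 4 * ((1 + r) * (1 + c)) := by exact_mod_cast he
    have hrc : r ≤ 2 := by nlinarith [Nat.zero_le (r * c)]
    interval_cases r <;> omega

/-- Every nonzero line contributes exactly 1: a line of sum r has r ones of weight 1/r. -/
lemma sum_weights (hz : NoZeroLine M) :
    ∑ i, ∑ j, (M i j : ℚ) * (((∑ z, M i z : ℕ) : ℚ)⁻¹ + ((∑ z, M z j : ℕ) : ℚ)⁻¹) = n + m := by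
  simp only [mul_add, Finset.sum_add_distrib]
  congr 1
  · have : ∀ i, ∑ j, (M i j : ℚ) * ((∑ z, M i z : ℕ) : ℚ)⁻¹ = 1 := fun i => by
      rw [← Finset.sum_mul, ← Nat.cast_sum]
      exact mul_inv_cancel₀ (Nat.cast_ne_zero.2 (Nat.one_le_iff_ne_zero.1 (row_sum_pos hz i)))
    simp only [this]; simp
  · rw [Finset.sum_comm]
    have : ∀ j, ∑ i, (M i j : ℚ) * ((∑ z, M z j : ℕ) : ℚ)⁻¹ = 1 := fun j => by
      rw [← Finset.sum_mul, ← Nat.cast_sum]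
      exact mul_inv_cancel₀ (Nat.cast_ne_zero.2 (Nat.one_le_iff_ne_zero.1 (col_sum_pos hz j)))
    simp only [this]; simp

lemma weight_le (hM : IsKTDSMatrix 2 M) (hz : NoZeroLine M) (i : Fin n) (j : Fin m) :
    (M i j : ℚ) * (((∑ z, M i z : ℕ) : ℚ)⁻¹ + ((∑ z, M z j : ℕ) : ℚ)⁻¹) ≤ M i j * (4 / 3) := by
  rcases hM.1 i j with h | h
  · simp [h]
  · simpa [h] using (inv_add_inv_le (row_sum_pos hz i) (col_sum_pos hz j) (four_le_of_one hM h)).1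

lemma sum_mul_four_thirds (hM : IsKTDSMatrix 2 M) :
    ∑ i, ∑ j, (M i j : ℚ) * (4 / 3) = numOnes M * (4 / 3) := by
  simp only [← Finset.sum_mul, numOnes_eq_sum hM.1]
  push_cast
  rfl

lemma three_mul_le (hM : IsKTDSMatrix 2 M) (hz : NoZeroLine M) :
    3 * (n + m) ≤ 4 * numOnes M := by
  have h := Finset.sum_le_sum fun i (_ : i ∈ Finset.univ) =>
    Finset.sum_le_sum fun j (_ : j ∈ Finset.univ) => weight_le hM hz i j
  rw [sum_weights hz, sum_mul_four_thirds hM] at h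
  have : (3 * (n + m) : ℚ) ≤ 4 * numOnes M := by linarith
  exact_mod_cast this

/-- Equality makes every weight equal to 4/3, so all row sums are 1 or 3 and the number of ones has
the parity of n. The congruence makes 3(n + m)/4 ≡ 3n + 3 mod 6, of the opposite parity. -/
lemma three_mul_ne (hM : IsKTDSMatrix 2 M) (hz : NoZeroLine M) (hmod : m ≡ 3 * n + 4 [MOD 8]) :
    3 * (n + m) ≠ 4 * numOnes M := by
  intro he
  have he' : (3 * (n + m) : ℚ) = 4 * numOnes M := by exact_mod_cast he
  have hsum : ∑ i, ∑ j, (M i j : ℚ) * (((∑ z, M i z : ℕ) : ℚ)⁻¹ + ((∑ z, M z j : ℕ) : ℚ)⁻¹) =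
      ∑ i, ∑ j, (M i j : ℚ) * (4 / 3) := by
    rw [sum_weights hz, sum_mul_four_thirds hM]; linarith
  have hrow := (Finset.sum_eq_sum_iff_of_le fun i _ =>
    Finset.sum_le_sum fun j _ => weight_le hM hz i j).1 hsum
  have hodd : ∀ i, ∃ x, ∑ z, M i z = 1 + 2 * x := by
    intro i
    obtain ⟨j, hj⟩ := hz.1 i
    have h1 : M i j = 1 := (hM.1 i j).resolve_left hj
    have hcell := (Finset.sum_eq_sum_iff_of_le fun j _ => weight_le hM hz i j).1
      (hrow i (Finset.mem_univ i)) j (Finset.mem_univ j)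
    rw [h1, Nat.cast_one, one_mul, one_mul] at hcell
    rcases (inv_add_inv_le (row_sum_pos hz i) (col_sum_pos hz j) (four_le_of_one hM h1)).2 hcell
      with h | h
    · exact ⟨0, h⟩
    · exact ⟨1, h⟩
  choose x hx using hodd
  have hN : numOnes M = n + 2 * ∑ i, x i := by
    rw [numOnes_eq_sum hM.1]
    simp [hx, Finset.sum_add_distrib, Finset.mul_sum]
  simp only [Nat.ModEq] at hmod
  omega

lemma le_numOnes_rows (hM : IsZeroOne M) (hz : NoZeroLine M) : n ≤ numOnes M := by
  rw [numOnes_eq_sum hM]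
  simpa using Finset.sum_le_sum fun i (_ : i ∈ Finset.univ) => row_sum_pos hz i

lemma le_numOnes_cols (hM : IsZeroOne M) (hz : NoZeroLine M) : m ≤ numOnes M := by
  refine le_of_le_of_eq ?_ ((numOnes_eq_sum hM).trans Finset.sum_comm).symm
  simpa using Finset.sum_le_sum fun j (_ : j ∈ Finset.univ) => col_sum_pos hz j

lemma IsKTDSMatrix.transpose {k : ℕ} (hM : IsKTDSMatrix k M) : IsKTDSMatrix k M.transpose := by
  refine ⟨fun i j => hM.1 j i, fun i j => (hM.2 j i).trans_eq ?_⟩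
  simp only [kappa, Matrix.transpose_apply]
  ring

lemma NoZeroLine.transpose (hz : NoZeroLine M) : NoZeroLine M.transpose := ⟨hz.2, hz.1⟩

lemma numOnes_transpose (hM : IsZeroOne M) : numOnes M.transpose = numOnes M := by
  have hM' : IsZeroOne M.transpose := fun i j => hM j i
  exact (numOnes_eq_sum hM').trans (Finset.sum_comm.trans (numOnes_eq_sum hM).symm)

end Counting

/-! ### Upper bounds from full rows and columns; the 2 × 3 case -/

section UpperBounds

lemma card_fin_lt {m y : ℕ} (h : y ≤ m) : (Finset.univ.filter fun j : Fin m => j.1 < y).card = y := by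
  simp [Fin.card_filter_val_lt, h]

/-- The `n × m` matrix whose first `y` columns are all ones. -/
def firstCols (n m y : ℕ) : Matrix (Fin n) (Fin m) ℕ := fun _ j => if j.1 < y then 1 else 0

lemma firstCols_isKTDSMatrix {n m y : ℕ} (hy : y ≤ m) (hy2 : 2 ≤ y) (h : 4 ≤ y + n) :
    IsKTDSMatrix 2 (firstCols n m y) := by
  refine ⟨fun i j => ?_, fun i j => ?_⟩
  · simp only [firstCols]; split_ifs <;> simp
  · have hr : ∑ z : Fin m, (firstCols n m y i z : ℤ) = y := by
      simp [firstCols, card_fin_lt hy]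
    simp only [kappa, hr]
    by_cases hj : j.1 < y <;> simp [firstCols, hj] <;> omega

lemma numOnes_firstCols {n m y : ℕ} (hy : y ≤ m) : numOnes (firstCols n m y) = n * y := by
  rw [numOnes_eq_sum fun i j => by simp only [firstCols]; split_ifs <;> simp]
  simp [firstCols, card_fin_lt hy]

lemma gammaT_le_mul_left {n m y : ℕ} (hy : y ≤ m) (hy2 : 2 ≤ y) (h : 4 ≤ y + n) :
    gammaT (rookGraph n m) 2 ≤ n * y :=
  (gammaT_le_numOnes (firstCols_isKTDSMatrix hy hy2 h)).trans_eq (numOnes_firstCols hy)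

lemma gammaT_le_mul_right {n m y : ℕ} (hy : y ≤ n) (hy2 : 2 ≤ y) (h : 4 ≤ y + m) :
    gammaT (rookGraph n m) 2 ≤ m * y := by
  have hM := firstCols_isKTDSMatrix (n := m) hy hy2 h
  refine (gammaT_le_numOnes hM.transpose).trans_eq ?_
  rw [numOnes_transpose hM.1, numOnes_firstCols hy]

/-- Two full columns give γ ≤ 4 for this shape, so a minimum matrix must have a zero line. The
weight bound allows four ones and does not detect this. -/
lemma numOnes_two_three {M : Matrix (Fin 2) (Fin 3) ℕ} (hM : IsKTDSMatrix 2 M)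
    (hz : NoZeroLine M) : 5 ≤ numOnes M := by
  have hr := row_sum_pos hz
  have hc := col_sum_pos hz
  have h4 := fun i j => four_le_of_one hM (i := i) (j := j)
  have h01 := hM.1
  rw [numOnes_eq_sum hM.1]
  simp only [IsZeroOne, Fin.forall_fin_succ, Fin.sum_univ_succ] at *
  simp at *
  omega

lemma numOnes_three_two {M : Matrix (Fin 3) (Fin 2) ℕ} (hM : IsKTDSMatrix 2 M)
    (hz : NoZeroLine M) : 5 ≤ numOnes M := by
  rw [← numOnes_transpose hM.1]
  exact numOnes_two_three hM.transpose hz.transpose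

end UpperBounds

/-! ### Components supported on a single line -/

section Components

variable {n m : ℕ} {M : Matrix (Fin n) (Fin m) ℕ}

/-- Only consecutive ones of a row are adjacent, so induct on the distance `d`, splitting at a one
in between. -/
lemma reachable_of_row_eq (p q : OneCell M) (h : p.1.1 = q.1.1) : (gammaGraph M).Reachable p q := by
  suffices H : ∀ d : ℕ, ∀ p q : OneCell M, p.1.1 = q.1.1 → p.1.2 ≤ q.1.2 →
      q.1.2.1 - p.1.2.1 ≤ d → (gammaGraph M).Reachable p q by
    rcases le_total p.1.2 q.1.2 with hle | hle
    · exact H _ p q h hle le_rfl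
    · exact (H _ q p h.symm hle le_rfl).symm
  intro d
  induction d with
  | zero =>
    intro p q h hle hd
    have : p = q := Subtype.ext (Prod.ext h (Fin.ext (by have := Fin.le_def.1 hle; omega)))
    rw [this]
  | succ d ih =>
    intro p q h hle hd
    by_cases hpq : p = q
    · rw [hpq]
    by_cases hb : ∃ j, p.1.2 < j ∧ j < q.1.2 ∧ M p.1.1 j = 1
    · obtain ⟨j, h1, h2, h3⟩ := hb
      have h1' := Fin.lt_def.1 h1
      have h2' := Fin.lt_def.1 h2
      exact (ih p ⟨(p.1.1, j), h3⟩ rfl h1.le (by simp only; omega)).trans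
        (ih ⟨(p.1.1, j), h3⟩ q h h2.le (by simp only; omega))
    · refine SimpleGraph.Adj.reachable ⟨hpq, Or.inl ⟨h, fun j h1 h2 h3 => hb ⟨j, ?_, ?_, h3⟩⟩⟩
      · rwa [min_eq_left hle] at h1
      · rwa [max_eq_right hle] at h2

lemma reachable_of_col_eq (p q : OneCell M) (h : p.1.2 = q.1.2) : (gammaGraph M).Reachable p q := by
  suffices H : ∀ d : ℕ, ∀ p q : OneCell M, p.1.2 = q.1.2 → p.1.1 ≤ q.1.1 →
      q.1.1.1 - p.1.1.1 ≤ d → (gammaGraph M).Reachable p q by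
    rcases le_total p.1.1 q.1.1 with hle | hle
    · exact H _ p q h hle le_rfl
    · exact (H _ q p h.symm hle le_rfl).symm
  intro d
  induction d with
  | zero =>
    intro p q h hle hd
    have : p = q := Subtype.ext (Prod.ext (Fin.ext (by have := Fin.le_def.1 hle; omega)) h)
    rw [this]
  | succ d ih =>
    intro p q h hle hd
    by_cases hpq : p = q
    · rw [hpq]
    by_cases hb : ∃ i, p.1.1 < i ∧ i < q.1.1 ∧ M i p.1.2 = 1
    · obtain ⟨i, h1, h2, h3⟩ := hb
      have h1' := Fin.lt_def.1 h1
      have h2' := Fin.lt_def.1 h2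
      exact (ih p ⟨(i, p.1.2), h3⟩ rfl h1.le (by simp only; omega)).trans
        (ih ⟨(i, p.1.2), h3⟩ q h h2.le (by simp only; omega))
    · refine SimpleGraph.Adj.reachable ⟨hpq, Or.inr ⟨h, fun i h1 h2 h3 => hb ⟨i, ?_, ?_, h3⟩⟩⟩
      · rwa [min_eq_left hle] at h1
      · rwa [max_eq_right hle] at h2

/-- A component all of whose ones lie on the rows `R` and the columns `C`, and which contains all
of `R × C`, is an all-ones matrix. -/
lemma isEquivTo_J {c : Component M} {R : Finset (Fin n)} {C : Finset (Fin m)}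
    (hR : c.rows = R) (hC : c.cols = C) (h : ∀ i ∈ R, ∀ j ∈ C, M i j = 1) :
    c.IsEquivTo (J R.card C.card) := by
  have e : Fin R.card ≃ c.rows := R.equivFin.symm.trans (Equiv.setCongr hR.symm)
  have f : Fin C.card ≃ c.cols := C.equivFin.symm.trans (Equiv.setCongr hC.symm)
  refine ⟨e, f, ?_⟩
  ext i j
  have hi : (e i : Fin n) ∈ R := Finset.mem_coe.1 (hR.subset (e i).2)
  have hj : (f j : Fin m) ∈ C := Finset.mem_coe.1 (hC.subset (f j).2)
  exact h _ hi _ hj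

/-- A walk could leave the row only along a column, and by `hi` each column through a one of row `i`
has no other one. -/
lemma reachable_row_eq {i : Fin n} (hi : ∀ j, M i j = 1 → ∀ i', M i' j = 1 → i' = i)
    {p q : OneCell M} (h : (gammaGraph M).Reachable p q) (hp : p.1.1 = i) : q.1.1 = i := by
  obtain ⟨w⟩ := h
  induction w with
  | nil => exact hp
  | @cons u v w huv _ ih =>
    refine ih ?_
    rcases huv.2 with h | h
    · exact h.1.symm.trans hp
    · exact hi v.1.2 (by rw [← h.1, ← hp]; exact u.2) _ v.2

lemma reachable_col_eq {j : Fin m} (hj : ∀ i, M i j = 1 → ∀ j', M i j' = 1 → j' = j)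
    {p q : OneCell M} (h : (gammaGraph M).Reachable p q) (hp : p.1.2 = j) : q.1.2 = j := by
  obtain ⟨w⟩ := h
  induction w with
  | nil => exact hp
  | @cons u v w huv _ ih =>
    refine ih ?_
    rcases huv.2 with h | h
    · exact hj v.1.1 (by rw [← h.1, ← hp]; exact u.2) _ v.2
    · exact h.1.symm.trans hp

lemma isEquivTo_row {i : Fin n} (hi : ∀ j, M i j = 1 → ∀ i', M i' j = 1 → i' = i)
    (p : OneCell M) (hp : p.1.1 = i) :
    Component.IsEquivTo ((gammaGraph M).connectedComponentMk p)
      (J 1 (Finset.univ.filter fun j => M i j = 1).card) := by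
  refine isEquivTo_J (R := {i}) ?_ ?_ (by simp)
  · ext x
    simp only [Component.rows, Set.mem_ofPred_eq, Finset.coe_singleton, Set.mem_singleton_iff]
    constructor
    · rintro ⟨q, hq, rfl⟩
      exact reachable_row_eq hi (SimpleGraph.ConnectedComponent.exact hq).symm hp
    · rintro rfl
      exact ⟨p, rfl, hp⟩
  · ext y
    simp only [Component.cols, Set.mem_ofPred_eq, Finset.coe_filter, Finset.mem_univ, true_and]
    constructor
    · rintro ⟨q, hq, rfl⟩
      rw [← reachable_row_eq hi (SimpleGraph.ConnectedComponent.exact hq).symm hp]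
      exact q.2
    · intro hy
      exact ⟨⟨(i, y), hy⟩, SimpleGraph.ConnectedComponent.sound
        (reachable_of_row_eq _ _ hp.symm), rfl⟩

lemma isEquivTo_col {j : Fin m} (hj : ∀ i, M i j = 1 → ∀ j', M i j' = 1 → j' = j)
    (p : OneCell M) (hp : p.1.2 = j) :
    Component.IsEquivTo ((gammaGraph M).connectedComponentMk p)
      (J (Finset.univ.filter fun i => M i j = 1).card 1) := by
  refine isEquivTo_J (C := {j}) ?_ ?_ (by simp)
  · ext x
    simp only [Component.rows, Set.mem_ofPred_eq, Finset.coe_filter, Finset.mem_univ, true_and]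
    constructor
    · rintro ⟨q, hq, rfl⟩
      rw [← reachable_col_eq hj (SimpleGraph.ConnectedComponent.exact hq).symm hp]
      exact q.2
    · intro hx
      exact ⟨⟨(x, j), hx⟩, SimpleGraph.ConnectedComponent.sound
        (reachable_of_col_eq _ _ hp.symm), rfl⟩
  · ext y
    simp only [Component.cols, Set.mem_ofPred_eq, Finset.coe_singleton, Set.mem_singleton_iff]
    constructor
    · rintro ⟨q, hq, rfl⟩
      exact reachable_col_eq hj (SimpleGraph.ConnectedComponent.exact hq).symm hp
    · rintro rfl
      exact ⟨p, rfl, hp⟩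

end Components

/-! ### The star matrices -/

section Stars

/-- Row `i` is one of `a` row stars, and column `j` is one of its leaves: the star has three leaves,
starting from column `b + 3 * i`, but the last star takes all the remaining columns. -/
def IsLeaf (a b i j : ℕ) : Prop := i < a ∧ b + 3 * i ≤ j ∧ (j < b + 3 * i + 3 ∨ i + 1 = a)

open Classical in
/-- The matrix made of `a` row stars and `b` column stars. -/
noncomputable def starMatrix (a b n m : ℕ) : Matrix (Fin n) (Fin m) ℕ :=
  Matrix.of fun i j => if IsLeaf a b i j ∨ IsLeaf b a j i then 1 else 0

variable {a b n m s t : ℕ}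

lemma starMatrix_eq_one {i : Fin n} {j : Fin m} :
    starMatrix a b n m i j = 1 ↔ IsLeaf a b i j ∨ IsLeaf b a j i := by
  rw [starMatrix, Matrix.of_apply]
  split_ifs with h <;> simp [h]

lemma starMatrix_isZeroOne : IsZeroOne (starMatrix a b n m) := by
  intro i j
  rw [starMatrix, Matrix.of_apply]
  split_ifs <;> simp

lemma starMatrix_transpose : (starMatrix a b n m).transpose = starMatrix b a m n := by
  ext i j
  simp only [starMatrix, Matrix.transpose_apply, Matrix.of_apply]
  split_ifs <;> tauto

lemma sum_eq_card {ι : Type*} [Fintype ι] {f : ι → ℕ} (hf : ∀ i, f i = 0 ∨ f i = 1) :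
    ∑ i, f i = (Finset.univ.filter fun i => f i = 1).card := by
  rw [Finset.card_filter]
  refine Finset.sum_congr rfl fun i _ => ?_
  rcases hf i with h | h <;> simp [h]

lemma card_fin_Ico {m u v : ℕ} (hv : v ≤ m) :
    (Finset.univ.filter fun j : Fin m => u ≤ j.1 ∧ j.1 < v).card = v - u := by
  rw [← Nat.card_Ico u v, ← Finset.card_map Fin.valEmbedding]
  congr 1
  ext x
  simp only [Finset.mem_map, Finset.mem_filter, Finset.mem_univ, true_and, Fin.valEmbedding_apply,
    Finset.mem_Ico]
  constructor
  · rintro ⟨j, hj, rfl⟩; exact hj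
  · intro hx; exact ⟨⟨x, by omega⟩, hx, rfl⟩

/-- The row of a leaf of a column star has exactly one one. -/
lemma card_row_leaf (hn : n = a + 3 * b + s) (hm : m = b + 3 * a + t) (hb : b = 0 → s = 0)
    (i : Fin n) (hi : a ≤ i.1) :
    (Finset.univ.filter fun j => starMatrix a b n m i j = 1).card = 1 := by
  have hib := i.2
  -- Leaf rows come in triples after the `a` centres. The `min` sends the `s` surplus rows to the
  -- last star, and `hb` guarantees `b ≥ 1` here.
  have : (Finset.univ.filter fun j => starMatrix a b n m i j = 1) =
      {⟨min ((i.1 - a) / 3) (b - 1), by omega⟩} := by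
    ext j
    have hjm := j.2
    simp only [Finset.mem_filter, Finset.mem_univ, true_and, starMatrix_eq_one, IsLeaf,
      Finset.mem_singleton, Fin.ext_iff]
    omega
  rw [this, Finset.card_singleton]

lemma card_row_center (hm : m = b + 3 * a + t) (i : Fin n) (hi : i.1 < a) :
    (Finset.univ.filter fun j => starMatrix a b n m i j = 1).card =
      if i.1 + 1 = a then 3 + t else 3 := by
  have : (Finset.univ.filter fun j => starMatrix a b n m i j = 1) =
      Finset.univ.filter fun j : Fin m =>
        b + 3 * i.1 ≤ j.1 ∧ j.1 < if i.1 + 1 = a then m else b + 3 * i.1 + 3 := by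
    ext j
    have hjm := j.2
    simp only [Finset.mem_filter, Finset.mem_univ, true_and, starMatrix_eq_one, IsLeaf]
    split_ifs <;> omega
  rw [this, card_fin_Ico (by split_ifs <;> omega)]
  split_ifs <;> omega

lemma card_col_eq (j : Fin m) : (Finset.univ.filter fun i => starMatrix a b n m i j = 1).card =
    (Finset.univ.filter fun i => starMatrix b a m n j i = 1).card := by
  rw [← starMatrix_transpose (a := a) (b := b)]
  rfl

/-- All line sums are at least 1, which settles the zeros. A one lies on a centre line of sum at
least 3 and a leaf line of sum 1. `ha` and `hb` say that surplus leaves have a star to join. -/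
lemma starMatrix_isKTDSMatrix (hn : n = a + 3 * b + s) (hm : m = b + 3 * a + t)
    (ha : a = 0 → t = 0) (hb : b = 0 → s = 0) : IsKTDSMatrix 2 (starMatrix a b n m) := by
  refine ⟨starMatrix_isZeroOne, fun i j => ?_⟩
  have hr := sum_eq_card (starMatrix_isZeroOne (a := a) (b := b) (n := n) (m := m) i)
  have hc := sum_eq_card fun i => starMatrix_isZeroOne (a := a) (b := b) (n := n) (m := m) i j
  rw [card_col_eq] at hc
  rw [kappa, ← Nat.cast_sum, ← Nat.cast_sum, hr, hc]
  have h1 := starMatrix_eq_one (a := a) (b := b) (i := i) (j := j)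
  rw [IsLeaf, IsLeaf] at h1
  have h01 := starMatrix_isZeroOne (a := a) (b := b) i j
  rcases lt_or_ge i.1 a with hi | hi <;> rcases lt_or_ge j.1 b with hj | hj
  · rw [card_row_center hm i hi, card_row_center hn j hj]
    split_ifs <;> omega
  · rw [card_row_center hm i hi, card_row_leaf hm hn ha j hj]
    split_ifs <;> omega
  · rw [card_row_leaf hn hm hb i hi, card_row_center hn j hj]
    split_ifs <;> omega
  · rw [card_row_leaf hn hm hb i hi, card_row_leaf hm hn ha j hj]
    omega

lemma numOnes_starMatrix (hn : n = a + 3 * b + s) (hm : m = b + 3 * a + t)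
    (ha : a = 0 → t = 0) (hb : b = 0 → s = 0) :
    numOnes (starMatrix a b n m) = 3 * a + t + 3 * b + s := by
  rw [numOnes_eq_sum starMatrix_isZeroOne]
  have h : ∀ i : Fin n, ∑ j, starMatrix a b n m i j =
      if i.1 < a then if i.1 + 1 = a then 3 + t else 3 else 1 := by
    intro i
    rw [sum_eq_card (starMatrix_isZeroOne i)]
    split_ifs with h1 h2
    · rw [card_row_center hm i h1, if_pos h2]
    · rw [card_row_center hm i h1, if_neg h2]
    · exact card_row_leaf hn hm hb i (not_lt.1 h1)
  rw [Finset.sum_congr rfl fun i _ => h i,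
    Fin.sum_univ_eq_sum_range (fun i => if i < a then if i + 1 = a then 3 + t else 3 else 1) n, hn,
    add_assoc, Finset.sum_range_add]
  have h2 : ∑ x ∈ Finset.range (3 * b + s),
      (if a + x < a then if a + x + 1 = a then 3 + t else 3 else 1) = 3 * b + s := by
    simp
  rw [h2]
  have h3 : ∑ x ∈ Finset.range a, (if x < a then if x + 1 = a then 3 + t else 3 else 1) =
      3 * a + t := by
    rcases a with _ | a
    · simp [ha rfl]
    · rw [Finset.sum_range_succ, Finset.sum_congr rfl (g := fun _ => 3)]
      · simp; ring
      · intro x hx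
        have := Finset.mem_range.1 hx
        rw [if_pos (by omega), if_neg (by omega)]
  omega

lemma starMatrix_row_unique (i : Fin n) (hi : i.1 < a) (j : Fin m)
    (h : starMatrix a b n m i j = 1) (i' : Fin n) (h' : starMatrix a b n m i' j = 1) : i' = i := by
  have h1 := i.2
  have h2 := i'.2
  simp only [starMatrix_eq_one, IsLeaf] at h h'
  ext
  omega

lemma starMatrix_col_unique (j : Fin m) (hj : j.1 < b) (i : Fin n)
    (h : starMatrix a b n m i j = 1) (j' : Fin m) (h' : starMatrix a b n m i j' = 1) : j' = j :=
  starMatrix_row_unique (a := b) (b := a) (n := m) (m := n) j hj i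
    (by rw [← starMatrix_transpose]; exact h) j' (by rw [← starMatrix_transpose]; exact h')

/-- The component of a one in a row star. -/
lemma starMatrix_row_component (hm : m = b + 3 * a + t) (p : OneCell (starMatrix a b n m))
    (hp : p.1.1.1 < a) : Component.IsEquivTo ((gammaGraph _).connectedComponentMk p)
      (J 1 (if p.1.1.1 + 1 = a then 3 + t else 3)) := by
  have h := isEquivTo_row (starMatrix_row_unique p.1.1 hp) p rfl
  rwa [card_row_center hm _ hp] at h

lemma starMatrix_col_component (hn : n = a + 3 * b + s) (p : OneCell (starMatrix a b n m))
    (hp : p.1.2.1 < b) : Component.IsEquivTo ((gammaGraph _).connectedComponentMk p)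
      (J (if p.1.2.1 + 1 = b then 3 + s else 3) 1) := by
  have h := isEquivTo_col (starMatrix_col_unique p.1.2 hp) p rfl
  rwa [card_col_eq, card_row_center hn _ hp] at h

/-- All components are short but for one row star with `t` extra leaves (if `t ≠ 0`) and one column
star with `s` extra leaves (if `s ≠ 0`). -/
lemma starMatrix_components (hn : n = a + 3 * b + s) (hm : m = b + 3 * a + t)
    (ha : a = 0 → t = 0) (hb : b = 0 → s = 0) :
    ∃ A B : Set (Component (starMatrix a b n m)),
      (t = 0 ∧ A = ∅ ∨ 0 < t ∧ ∃ c, A = {c} ∧ c.IsEquivTo (J 1 (3 + t))) ∧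
      (s = 0 ∧ B = ∅ ∨ 0 < s ∧ ∃ c, B = {c} ∧ c.IsEquivTo (J (3 + s) 1)) ∧
      ∀ c, c ∉ A → c ∉ B → c.IsShort := by
  have hA : ∃ A : Set (Component (starMatrix a b n m)),
      (t = 0 ∧ A = ∅ ∨ 0 < t ∧ ∃ c, A = {c} ∧ c.IsEquivTo (J 1 (3 + t))) ∧
      ∀ p : OneCell (starMatrix a b n m), p.1.1.1 < a →
        (gammaGraph _).connectedComponentMk p ∉ A →
        Component.IsShort ((gammaGraph _).connectedComponentMk p) := by
    rcases Nat.eq_zero_or_pos t with rfl | ht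
    · refine ⟨∅, Or.inl ⟨rfl, rfl⟩, fun p hp _ => Or.inl ?_⟩
      have h := starMatrix_row_component hm p hp
      rwa [Nat.add_zero, ite_self] at h
    -- The first leaf of the last row star represents the long component; `0 < t` and `ha` give `0 <
    -- a`.
    · have h1 : starMatrix a b n m ⟨a - 1, by omega⟩ ⟨b + 3 * (a - 1), by omega⟩ = 1 := by
        rw [starMatrix_eq_one, IsLeaf]
        left; simp only; omega
      let p₀ : OneCell (starMatrix a b n m) := ⟨(_, _), h1⟩
      have hp₀ : p₀.1.1.1 = a - 1 := rfl
      refine ⟨{(gammaGraph _).connectedComponentMk p₀}, Or.inr ⟨ht, _, rfl, ?_⟩, fun p hp hne => ?_⟩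
      · have h := starMatrix_row_component hm p₀ (by omega)
        rwa [if_pos (by omega)] at h
      · have h := starMatrix_row_component hm p hp
        rw [if_neg] at h
        · exact Or.inl h
        · intro hpa
          exact hne (SimpleGraph.ConnectedComponent.sound
            (reachable_of_row_eq _ _ (Fin.ext (by omega))))
  have hB : ∃ B : Set (Component (starMatrix a b n m)),
      (s = 0 ∧ B = ∅ ∨ 0 < s ∧ ∃ c, B = {c} ∧ c.IsEquivTo (J (3 + s) 1)) ∧
      ∀ p : OneCell (starMatrix a b n m), p.1.2.1 < b →
        (gammaGraph _).connectedComponentMk p ∉ B →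
        Component.IsShort ((gammaGraph _).connectedComponentMk p) := by
    rcases Nat.eq_zero_or_pos s with rfl | hs
    · refine ⟨∅, Or.inl ⟨rfl, rfl⟩, fun p hp _ => Or.inr ?_⟩
      have h := starMatrix_col_component hn p hp
      rwa [Nat.add_zero, ite_self] at h
    · have h1 : starMatrix a b n m ⟨a + 3 * (b - 1), by omega⟩ ⟨b - 1, by omega⟩ = 1 := by
        rw [starMatrix_eq_one, IsLeaf, IsLeaf]
        right; simp only; omega
      let p₀ : OneCell (starMatrix a b n m) := ⟨(_, _), h1⟩
      have hp₀ : p₀.1.2.1 = b - 1 := rfl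
      refine ⟨{(gammaGraph _).connectedComponentMk p₀}, Or.inr ⟨hs, _, rfl, ?_⟩, fun p hp hne => ?_⟩
      · have h := starMatrix_col_component hn p₀ (by omega)
        rwa [if_pos (by omega)] at h
      · have h := starMatrix_col_component hn p hp
        rw [if_neg] at h
        · exact Or.inr h
        · intro hpb
          exact hne (SimpleGraph.ConnectedComponent.sound
            (reachable_of_col_eq _ _ (Fin.ext (by omega))))
  obtain ⟨A, hA1, hA2⟩ := hA
  obtain ⟨B, hB1, hB2⟩ := hB
  refine ⟨A, B, hA1, hB1, fun c => ?_⟩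
  refine SimpleGraph.ConnectedComponent.ind (fun p => ?_) c
  intro h1 h2
  rcases starMatrix_eq_one.1 p.2 with h | h
  · exact hA2 p h.1 h1
  · exact hB2 p h.1 h2

end Stars

/-! ### Choice of the parameters -/

/-- Eliminating a gives 3n − m = 8b + 3s − t, and counting ones gives s + t = 4L − 3(n + m). So the
residue of 3n − m mod 8 dictates the possible (s, t), with s + t = 4 for residue 4 and s + t ≤ 3
otherwise. What remains is to keep a and b nonnegative, and positive where surplus leaves need a
star. -/
lemma exists_star_parameters {n m N L : ℕ} (hn : 1 ≤ n) (hm : 1 ≤ m)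
    (hnm : (n, m) ∉ ({(1, 1), (1, 2), (2, 1), (2, 2), (3, 3), (3, 4), (4, 3)} : Set (ℕ × ℕ)))
    (h23 : ¬(n = 2 ∧ m = 3)) (h32 : ¬(n = 3 ∧ m = 2))
    (hnN : n ≤ N) (hmN : m ≤ N)
    (h1n : n = 1 → 3 ≤ m → N ≤ 3) (h1m : m = 1 → 3 ≤ n → N ≤ 3)
    (h2n : 2 ≤ n → 2 ≤ m → N ≤ n * 2) (h2m : 2 ≤ n → 2 ≤ m → N ≤ m * 2) (hLN : L ≤ N)
    (hL : m % 8 = (3 * n + 4) % 8 ∧ 4 * L = 3 * (n + m) + 4 ∨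
      m % 8 ≠ (3 * n + 4) % 8 ∧ 3 * (n + m) ≤ 4 * L ∧ 4 * L < 3 * (n + m) + 4) :
    ∃ a b s t, n = a + 3 * b + s ∧ m = b + 3 * a + t ∧ (a = 0 → t = 0) ∧ (b = 0 → s = 0) ∧
      3 * a + t + 3 * b + s = L ∧ (s = 0 ∧ t ≤ 4 ∨ t = 0 ∧ s ≤ 4 ∨ s ≤ 2 ∧ t ≤ 2) := by
  have hN : 3 * (n + m) ≤ 4 * N := by clear hnm h23 h32 h1n h1m h2n h2m; omega
  simp only [Set.mem_insert_iff, Set.mem_singleton_iff, Prod.mk.injEq] at hnm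
  rcases eq_or_lt_of_le hn with rfl | hn2
  · have h3 : 3 ≤ m := by by_contra h; clear hL; omega
    have := h1n rfl h3
    obtain rfl : m = 3 := by clear hL hnm; omega
    exact ⟨1, 0, 0, 0, by clear hnm; omega⟩
  rcases eq_or_lt_of_le hm with rfl | hm2
  · have h3 : 3 ≤ n := by by_contra h; clear hL; omega
    have := h1m rfl h3
    obtain rfl : n = 3 := by clear hL hnm; omega
    exact ⟨0, 1, 0, 0, by clear hnm; omega⟩
  have hNn := h2n hn2 hm2
  have hNm := h2m hn2 hm2
  clear h1n h1m h2n h2m hnN hmN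
  -- From 3(n + m) ≤ 4N ≤ 8n, and symmetrically below.
  have hmn : 3 * m ≤ 5 * n := by clear hL hnm h23 h32; omega
  have hnm' : 3 * n ≤ 5 * m := by clear hL hnm h23 h32; omega
  -- Here the congruence holds, so L = 7, whereas N ≤ 6.
  have h35 : ¬(n = 3 ∧ m = 5) := by clear hnm h23 h32; rintro ⟨rfl, rfl⟩; omega
  have h53 : ¬(n = 5 ∧ m = 3) := by clear hnm h23 h32; rintro ⟨rfl, rfl⟩; omega
  have hnm4 : 4 ≤ n ∧ 4 ≤ m := by
    clear hL hNn hNm hLN hN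
    by_contra hlt
    have hn5 : n ≤ 5 := by clear hnm h23 h32 h35 h53; omega
    have hm5 : m ≤ 5 := by clear hnm h23 h32 h35 h53; omega
    interval_cases n <;> interval_cases m <;> simp_all
  obtain ⟨hn4, hm4⟩ := hnm4
  clear hn hm hnm h23 h32 hLN hNn hNm hn2 hm2 hN h35 h53
  -- The subtraction is not truncated, since 3m ≤ 5n gives m ≤ 3n.
  obtain ⟨k, r, hr, hk⟩ : ∃ k r, r < 8 ∧ 3 * n = m + r + 8 * k :=
    ⟨(3 * n - m) / 8, (3 * n - m) % 8, Nat.mod_lt _ (by norm_num), by omega⟩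
  have hr4 : m % 8 = (3 * n + 4) % 8 ↔ r = 4 := by omega
  rw [hr4, Ne, hr4] at hL
  clear hr4
  interval_cases r
  · exact ⟨n - 3 * k, k, 0, 0, by omega⟩
  · by_cases h : 2 ≤ k
    · exact ⟨n - 3 * k, k - 1, 3, 0, by omega⟩
    · exact ⟨n - 3 * k - 1, k, 1, 2, by omega⟩
  · exact ⟨n - 3 * k - 1, k, 1, 1, by omega⟩
  · exact ⟨n - 3 * k - 1, k, 1, 0, by omega⟩
  · by_cases h : 2 ≤ k
    · exact ⟨n - 3 * k - 1, k - 1, 4, 0, by omega⟩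
    -- With 3n = m + 4 + 8k this says n − 3k − 3 ≥ 1, so that a row star exists to take the four
    -- extra leaves. The other branch occurs only for n = m = 6.
    by_cases h' : n + 20 ≤ 3 * m
    · exact ⟨n - 3 * k - 3, k + 1, 0, 4, by omega⟩
    · exact ⟨n - 3 * k - 2, k, 2, 2, by omega⟩
  · by_cases h : n + 17 ≤ 3 * m
    · exact ⟨n - 3 * k - 3, k + 1, 0, 3, by omega⟩
    · exact ⟨n - 3 * k - 2, k, 2, 1, by omega⟩
  · by_cases h : 1 ≤ k
    · exact ⟨n - 3 * k - 2, k, 2, 0, by omega⟩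
    · exact ⟨n - 3 * k - 3, k + 1, 0, 2, by omega⟩
  · exact ⟨n - 3 * k - 3, k + 1, 0, 1, by omega⟩

end RookDom

theorem mainTheorem3 (n m : ℕ) (hn : 1 ≤ n) (hm : 1 ≤ m)
    (hnm : (n, m) ∉ ({(1, 1), (1, 2), (2, 1), (2, 2), (3, 3), (3, 4), (4, 3)} : Set (ℕ × ℕ)))
    (hex : ∃ M₀ : Matrix (Fin n) (Fin m) ℕ,
      RookDom.IsMinKTDSMatrix 2 M₀ ∧ RookDom.NoZeroLine M₀) :
    ∃ M : Matrix (Fin n) (Fin m) ℕ,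
      RookDom.IsMinKTDSMatrix 2 M ∧
      ((∀ c : RookDom.Component M, c.IsShort) ∨
       (∃ (c₁ : RookDom.Component M) (x : ℕ), 4 ≤ x ∧ x ≤ 7 ∧
          c₁.IsEquivTo (RookDom.J x 1) ∧
          ∀ c : RookDom.Component M, c ≠ c₁ → c.IsShort) ∨
       (∃ (c₂ : RookDom.Component M) (y : ℕ), 4 ≤ y ∧ y ≤ 7 ∧
          c₂.IsEquivTo (RookDom.J 1 y) ∧
          ∀ c : RookDom.Component M, c ≠ c₂ → c.IsShort) ∨
       (∃ (c₁ c₂ : RookDom.Component M) (x y : ℕ), 4 ≤ x ∧ x ≤ 5 ∧ 4 ≤ y ∧ y ≤ 5 ∧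
          c₁.IsEquivTo (RookDom.J x 1) ∧ c₂.IsEquivTo (RookDom.J 1 y) ∧
          ∀ c : RookDom.Component M, c ≠ c₁ → c ≠ c₂ → c.IsShort)) ∧
      RookDom.numOnes M =
        ⌈(3 * ((n : ℚ) + (m : ℚ)) / 4)⌉₊ + (if m ≡ 3 * n + 4 [MOD 8] then 1 else 0) := by
  open RookDom in
  obtain ⟨M₀, ⟨hM₀, hmin⟩, hz⟩ := hex
  set L := ⌈(3 * ((n : ℚ) + (m : ℚ)) / 4)⌉₊ + (if m ≡ 3 * n + 4 [MOD 8] then 1 else 0) with hLdef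
  have hle := three_mul_le hM₀ hz
  have hne := three_mul_ne hM₀ hz
  have hc1 : 3 * (n + m) ≤ 4 * ⌈(3 * ((n : ℚ) + (m : ℚ)) / 4)⌉₊ := by
    have := Nat.le_ceil (3 * ((n : ℚ) + (m : ℚ)) / 4)
    have h : (3 * (n + m) : ℚ) ≤ 4 * ⌈(3 * ((n : ℚ) + (m : ℚ)) / 4)⌉₊ := by linarith
    exact_mod_cast h
  have hc2 : 4 * ⌈(3 * ((n : ℚ) + (m : ℚ)) / 4)⌉₊ < 3 * (n + m) + 4 := by
    have := Nat.ceil_lt_add_one (a := 3 * ((n : ℚ) + (m : ℚ)) / 4) (by positivity)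
    have h : (4 * ⌈(3 * ((n : ℚ) + (m : ℚ)) / 4)⌉₊ : ℚ) < 3 * (n + m) + 4 := by linarith
    exact_mod_cast h
  have hL : m % 8 = (3 * n + 4) % 8 ∧ 4 * L = 3 * (n + m) + 4 ∨
      m % 8 ≠ (3 * n + 4) % 8 ∧ 3 * (n + m) ≤ 4 * L ∧ 4 * L < 3 * (n + m) + 4 := by
    by_cases h : m ≡ 3 * n + 4 [MOD 8]
    · rw [if_pos h] at hLdef
      have hne' := hne h
      rw [Nat.ModEq] at h
      omega
    · rw [if_neg h] at hLdef
      rw [Nat.ModEq] at h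
      omega
  have hLN : L ≤ numOnes M₀ := by
    simp only [Nat.ModEq] at hne
    omega
  obtain ⟨a, b, s, t, rfl, rfl, ha, hb, hst, hsmall⟩ := exists_star_parameters hn hm hnm
    (by
      rintro ⟨rfl, rfl⟩
      have h := gammaT_le_mul_left (n := 2) (m := 3) (y := 2) (by norm_num) le_rfl (by norm_num)
      have := numOnes_two_three hM₀ hz
      omega)
    (by
      rintro ⟨rfl, rfl⟩
      have h := gammaT_le_mul_right (n := 3) (m := 2) (y := 2) (by norm_num) le_rfl (by norm_num)
      have := numOnes_three_two hM₀ hz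
      omega)
    (le_numOnes_rows hM₀.1 hz) (le_numOnes_cols hM₀.1 hz)
    (by
      rintro rfl h3
      simpa [hmin] using gammaT_le_mul_left (n := 1) h3 (by norm_num) (by norm_num))
    (by
      rintro rfl h3
      simpa [hmin] using gammaT_le_mul_right (m := 1) h3 (by norm_num) (by norm_num))
    (fun h2 h2' => hmin.trans_le (gammaT_le_mul_left h2' le_rfl (by omega)))
    (fun h2 h2' => hmin.trans_le (gammaT_le_mul_right h2 le_rfl (by omega)))
    hLN hL
  have hM := starMatrix_isKTDSMatrix rfl rfl ha hb
  have hN := (numOnes_starMatrix rfl rfl ha hb).trans hst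
  -- Minimality: the star matrix has L ones, and L ≤ `numOnes M₀` = γ.
  refine ⟨starMatrix a b _ _, ⟨hM, le_antisymm ?_ (gammaT_le_numOnes hM)⟩, ?_, hN⟩
  · rw [hN, ← hmin]; exact hLN
  obtain ⟨A, B, hA, hB, hAB⟩ := starMatrix_components (s := s) (t := t) rfl rfl ha hb
  rcases hA with ⟨ht, rfl⟩ | ⟨ht, c₂, rfl, hc₂⟩ <;>
    rcases hB with ⟨hs, rfl⟩ | ⟨hs, c₁, rfl, hc₁⟩
  · exact Or.inl fun c => hAB c (Set.notMem_empty c) (Set.notMem_empty c)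
  · exact Or.inr (Or.inl ⟨c₁, 3 + s, by omega, by omega, hc₁,
      fun c hc => hAB c (Set.notMem_empty c) hc⟩)
  · exact Or.inr (Or.inr (Or.inl ⟨c₂, 3 + t, by omega, by omega, hc₂,
      fun c hc => hAB c hc (Set.notMem_empty c)⟩))
  · exact Or.inr (Or.inr (Or.inr ⟨c₁, c₂, 3 + s, 3 + t, by omega, by omega, by omega, by omega,
      hc₁, hc₂, fun c h₁ h₂ => hAB c h₂ h₁⟩))
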